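/- **Setting.** Let $d\ge 1$, $\alpha>d$, $\lambda>0$, let $W$ be a random variable with $\mathbb P(W\ge 1)=1$, and let $L$ be a random variable with distribution function $F_L(t)=\mathbb P(L\le t)$. The weighted scale-free percolation $\mathrm{SFP}_{W,L}$ on $\mathbb Z^d$ is the following random weighted graph. The vertices $x\in\mathbb Z^d$ carry i.i.d. vertex-weights $W_x$ distributed as $W$. Any two vertices at Euclidean distance $1$ are joined by an edge. Given $(W_x)_{x\in\mathbb Z^d}$, any two vertices $x,y$ with $\|x-y\|>1$ are joined, independently of all other pairs, with probability $1-\exp\{-\lambda W_xW_y/\|x-y\|^\alpha\}$. The edges $e$ carry i.i.d. edge-weights $L_e$ distributed as $L$, independent of the graph and of the vertex-weights. Let $\mathrm d_L(x,y)$ be the infimum of $\sum_{e\in\pi}L_e$ over all paths $\pi$ from $x$ to $y$, let $B^L_t(x)=\{y\in\mathbb Z^d:\mathrm d_L(x,y)\le t\}$ for $t\ge 0$, and let $$\tau_n(x)=\inf\{t\ge 0:|B^L_t(x)|=n\},\qquad \tau^{\ge}_n(x)=\inf\{t\ge 0:|B^L_t(x)|\ge n\}\qquad(\inf\emptyset=\infty).$$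 **Assumptions.** $F_L(0)=0$, and $W$ has tail parameter $\gamma>2$, that is, either $\mathbb P(W>t)=\ell(t)/t^{\tau-1}$ for all $t>0$, with some $\tau>1$ such that $\gamma:=\alpha(\tau-1)/d>2$ and some function $\ell$ varying slowly at infinity ($\lim_{t\to\infty}\ell(ct)/\ell(t)=1$ for every $c>0$), or the tail of $W$ is thinner than every power law: $\lim_{t\to\infty}t^s\,\mathbb P(W>t)=0$ for every $s>0$. **Claim.** There are deterministic constants $C,c>0$, depending only on $d,\alpha,\lambda$ and the distributions of $W$ and $L$, such that for every $x\in\mathbb Z^d$, almost surely: 1. there is a (random) $t_0$ such that $B^L_t(x)$ is finite and $|B_t^L(x)|\le e^{Ct}$ for all $t\ge t_0$; 2. there is a (random) $n_0$ such that $\tau_n(x)\ge c\log n$ and $\tau^{\ge}_n(x)\ge c\log n$ for all $n\ge n_0$; 3. $\tau_n(x)\to\infty$ and $\tau_n^{\ge}(x)\to\infty$ as $n\to\infty$; 4. explosion does not occur: $B_t^L(x)$ is finite for every $t<\infty$. -/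

import Mathlib

open MeasureTheory ProbabilityTheory Filter Topology Set
open scoped NNReal ENNReal

universe u

namespace SFP

/-- The vertex set `ℤ^d`. -/
abbrev Lattice (d : ℕ) : Type := Fin d → ℤ

/-- Euclidean distance of two lattice points. -/
noncomputable def eucl {d : ℕ} (x y : Lattice d) : ℝ :=
  Real.sqrt (∑ i, ((x i : ℝ) - (y i : ℝ)) ^ 2)

theorem eucl_comm {d : ℕ} (x y : Lattice d) : eucl x y = eucl y x := by
  unfold eucl
  congr 1
  exact Finset.sum_congr rfl fun i _ => by ring

/-- The two end points of the unordered pair `e` are at Euclidean distance larger than one. -/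
def IsLong {d : ℕ} (e : Sym2 (Lattice d)) : Prop :=
  ∃ x y, e = s(x, y) ∧ 1 < eucl x y

/-- The probability `1 - exp (-lam * w x * w y / ‖x - y‖ ^ α)` that the pair `e = {x, y}` is an
edge, given the vertex-weights `w`. -/
noncomputable def edgeProb {d : ℕ} (α lam : ℝ) (w : Lattice d → ℝ) : Sym2 (Lattice d) → ℝ :=
  Sym2.lift ⟨fun x y => 1 - Real.exp (-(lam * (w x * w y) / eucl x y ^ α)), fun x y => by
    simp only [eucl_comm x y, mul_comm (w x) (w y)]⟩

/-- The σ-algebra generated by the vertex-weights. -/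
abbrev sigmaWeights {Ω : Type u} {d : ℕ} (W : Lattice d → Ω → ℝ) : MeasurableSpace Ω :=
  ⨆ x, MeasurableSpace.comap (W x) inferInstance

/-- The σ-algebra generated by the random graph. -/
abbrev sigmaGraph {Ω : Type u} {d : ℕ} (G : Ω → SimpleGraph (Lattice d)) : MeasurableSpace Ω :=
  MeasurableSpace.generateFrom {s | ∃ x y, s = {ω | (G ω).Adj x y}}

/-- The σ-algebra generated by the edge-weights. -/
abbrev sigmaLengths {Ω : Type u} {d : ℕ} (L : Sym2 (Lattice d) → Ω → ℝ) : MeasurableSpace Ω :=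
  ⨆ e, MeasurableSpace.comap (L e) inferInstance

/-- `(W, G, L)`, defined on the probability space `(Ω, μ)`, is a scale-free percolation on `ℤ^d`
with long-range parameter `α`, percolation parameter `lam`, vertex-weight distribution `νW` and
edge-weight distribution `νL`. The fields prescribe exactly the joint law: the vertex-weights are
i.i.d.; nearest neighbours are joined; given the vertex-weights, the other pairs are edges
independently of each other with the probabilities `edgeProb`; the edge-weights are i.i.d. and
independent of the vertex-weights and the graph. An edge-weight is attached to every unordered
pair, but only those of the edges of the graph are ever used. -/
structure IsScaleFreePercolation {Ω : Type u} [MeasurableSpace Ω] (μ : Measure Ω) {d : ℕ}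
    (α lam : ℝ) (νW νL : Measure ℝ) (W : Lattice d → Ω → ℝ) (G : Ω → SimpleGraph (Lattice d))
    (L : Sym2 (Lattice d) → Ω → ℝ) : Prop where
  measurable_weight : ∀ x, Measurable (W x)
  law_weight : ∀ x, μ.map (W x) = νW
  indep_weight : iIndepFun W μ
  measurable_adj : ∀ x y, MeasurableSet {ω | (G ω).Adj x y}
  nearest : ∀ᵐ ω ∂μ, ∀ x y, eucl x y = 1 → (G ω).Adj x y
  cond_edges : ∀ F : Finset (Sym2 (Lattice d)), (∀ e ∈ F, IsLong e) →
    μ[Set.indicator {ω | ∀ e ∈ F, e ∈ (G ω).edgeSet} (fun _ => (1 : ℝ)) | sigmaWeights W]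
      =ᵐ[μ] fun ω => ∏ e ∈ F, edgeProb α lam (fun x => W x ω) e
  measurable_length : ∀ e, Measurable (L e)
  law_length : ∀ e, μ.map (L e) = νL
  indep_length : iIndepFun L μ
  indep_graph_length : Indep (sigmaWeights W ⊔ sigmaGraph G) (sigmaLengths L) μ

/-- `ℓ` varies slowly at infinity. -/
def SlowlyVarying (ℓ : ℝ → ℝ) : Prop :=
  ∀ c : ℝ, 0 < c → Tendsto (fun t => ℓ (c * t) / ℓ t) atTop (𝓝 1)

/-- `ν` has a power-law tail with exponent `τ`: `ν (t, ∞) = ℓ t / t ^ (τ - 1)` with `ℓ` slowly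
varying. -/
def IsPowerLaw (ν : Measure ℝ) (τ : ℝ) : Prop :=
  ∃ ℓ : ℝ → ℝ, SlowlyVarying ℓ ∧ ∀ t : ℝ, 0 < t → ν.real (Ioi t) = ℓ t / t ^ (τ - 1)

/-- The tail of `ν` is thinner than every power law. -/
def IsThinTailed (ν : Measure ℝ) : Prop :=
  ∀ s : ℝ, 0 < s → Tendsto (fun t : ℝ => t ^ s * ν.real (Ioi t)) atTop (𝓝 0)

/-- The total edge-weight of a walk. Edge-weights are almost surely positive, so `ENNReal.ofReal`
changes them at most on a null set. -/
noncomputable def walkLength {V : Type*} {G : SimpleGraph V} (L : Sym2 V → ℝ) {x y : V}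
    (p : G.Walk x y) : ℝ≥0∞ :=
  (p.edges.map fun e => ENNReal.ofReal (L e)).sum

/-- The `L`-distance: the infimum of the total edge-weight over the paths from `x` to `y`. -/
noncomputable def distL {V : Type*} (G : SimpleGraph V) (L : Sym2 V → ℝ) (x y : V) : ℝ≥0∞ :=
  ⨅ p : G.Path x y, walkLength L (p : G.Walk x y)

/-- The ball of radius `t` around `x` for the `L`-distance. -/
def ballL {V : Type*} (G : SimpleGraph V) (L : Sym2 V → ℝ) (x : V) (t : ℝ≥0) : Set V :=
  {y | distL G L x y ≤ t}

/-- `inf {t : |B_t(x)| = n}`, with `inf ∅ = ∞`. -/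
noncomputable def hitTime {V : Type*} (G : SimpleGraph V) (L : Sym2 V → ℝ) (x : V) (n : ℕ) :
    ℝ≥0∞ :=
  ⨅ (t : ℝ≥0) (_ : (ballL G L x t).encard = n), (t : ℝ≥0∞)

/-- `inf {t : |B_t(x)| ≥ n}`, with `inf ∅ = ∞`; this differs from `hitTime` only if the size of the
ball jumps over `n`. -/
noncomputable def passTime {V : Type*} (G : SimpleGraph V) (L : Sym2 V → ℝ) (x : V) (n : ℕ) :
    ℝ≥0∞ :=
  ⨅ (t : ℝ≥0) (_ : (n : ℕ∞) ≤ (ballL G L x t).encard), (t : ℝ≥0∞)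

end SFP

/-! The proof is a discounted first-moment count of self-avoiding paths. Let Z be the sum, over all
self-avoiding paths from x, of exp(-θ · length). A vertex within distance t of x is the end of a
path of length below t + 1, which contributes at least exp(-θ(t + 1)) to Z. Hence |B_t(x)| ≤ Z
exp(θ(t + 1)) (`encard_ballL_le`), and all claims follow once Z is almost surely finite for some
deterministic θ.

Finiteness comes from E Z < ∞. The bound 1 - exp(-z) ≤ z^s, with 0 ≤ s ≤ 1, replaces an edge
probability by a constant times (W_x W_y)^s ‖x - y‖^(-αs). Along a path each vertex meets at most
two edges, so by self-avoidance and independence a path with n edges costs at most M^(n+1), M = E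
W^(2s), times the product of its spatial kernels (`measure_path_le`). The kernel sums over a step
are at most A < ∞ when αs > d, and the independent edge-weights contribute φ(θ)^n, where φ(θ) = E
exp(-θL). Thus E Z ≤ M ∑ (A M φ(θ))^n (`tsum_pathWeight_ne_top`).

The condition γ > 2 leaves room for an s with αs > d and M < ∞ (`exists_moment_exponent`). Since L >
0 almost surely, φ(θ) → 0, so a large θ makes the series converge. -/

namespace SFP

/-! ### Deterministic part: ball growth from a discounted sum over paths -/

/-- The successive pairs of the vertex sequence `x :: l`. -/
def chainEdges {V : Type*} : V → List V → List (Sym2 V)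
  | _, [] => []
  | x, y :: l => s(x, y) :: chainEdges y l

theorem length_chainEdges {V : Type*} (x : V) (l : List V) :
    (chainEdges x l).length = l.length := by
  induction l generalizing x with
  | nil => rfl
  | cons y l ih => simp [chainEdges, ih]

theorem mem_of_mem_chainEdges {V : Type*} {x v : V} {l : List V} {e : Sym2 V}
    (he : e ∈ chainEdges x l) (hv : v ∈ e) : v ∈ x :: l := by
  induction l generalizing x with
  | nil => simp [chainEdges] at he
  | cons y l ih =>
    rcases List.mem_cons.1 he with rfl | he
    · rcases Sym2.mem_iff.1 hv with rfl | rfl <;> simp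
    · exact List.mem_cons_of_mem _ (ih he)

theorem nodup_chainEdges {V : Type*} {x : V} {l : List V} (h : (x :: l).Nodup) :
    (chainEdges x l).Nodup := by
  induction l generalizing x with
  | nil => exact List.nodup_nil
  | cons y l ih =>
    rw [List.nodup_cons] at h
    refine List.nodup_cons.2 ⟨fun he => h.1 ?_, ih h.2⟩
    exact mem_of_mem_chainEdges he (Sym2.mem_mk_left x y)

theorem not_isDiag_of_mem_chainEdges {V : Type*} {x : V} {l : List V} (h : (x :: l).Nodup)
    {e : Sym2 V} (he : e ∈ chainEdges x l) : ¬ e.IsDiag := by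
  induction l generalizing x with
  | nil => simp [chainEdges] at he
  | cons y l ih =>
    rw [List.nodup_cons] at h
    rcases List.mem_cons.1 he with rfl | he
    · rw [Sym2.mk_isDiag_iff]
      rintro rfl
      exact h.1 List.mem_cons_self
    · exact ih h.2 he

theorem exists_chain_of_walk {V : Type*} {G : SimpleGraph V} {x y : V} (p : G.Walk x y) :
    ∃ l : List V, p.support = x :: l ∧ p.edges = chainEdges x l ∧
      (x :: l).getLast (List.cons_ne_nil x l) = y := by
  induction p with
  | nil => exact ⟨[], by simp [chainEdges]⟩
  | @cons u v w h p ih =>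
    obtain ⟨l, h1, h2, h3⟩ := ih
    exact ⟨v :: l, by simp [h1], by simp [h2, chainEdges], by simpa using h3⟩

/-- The discount `exp (-θ r⁺)` of an edge of weight `r`. -/
noncomputable def discount (θ r : ℝ) : ℝ≥0∞ := ENNReal.ofReal (Real.exp (-(θ * max r 0)))

/-- `ENNReal.ofReal` truncates negative weights just as the maximum in `discount` does, so the
product of discounts is the exponential of -θ times the walk length. -/
theorem prod_discount (θ : ℝ) (hθ : 0 ≤ θ) {V : Type*} (L : Sym2 V → ℝ) (E : List (Sym2 V))
    (t : ℝ≥0) (h : (E.map fun e => ENNReal.ofReal (L e)).sum ≤ t) :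
    ENNReal.ofReal (Real.exp (-(θ * t))) ≤ (E.map fun e => discount θ (L e)).prod := by
  have key : (E.map fun e => discount θ (L e)).prod =
      ENNReal.ofReal (Real.exp (-(θ * (E.map fun e => max (L e) 0).sum))) := by
    clear h
    induction E with
    | nil => simp
    | cons e E ih =>
      rw [List.map_cons, List.prod_cons, List.map_cons, List.sum_cons, ih, discount]
      rw [← ENNReal.ofReal_mul (Real.exp_pos _).le, ← Real.exp_add]
      ring_nf
  have hs : (E.map fun e => ENNReal.ofReal (L e)).sum =
      ENNReal.ofReal (E.map fun e => max (L e) 0).sum ∧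
      0 ≤ (E.map fun e => max (L e) 0).sum := by
    clear h key
    induction E with
    | nil => simp
    | cons e E ih =>
      simp only [List.map_cons, List.sum_cons, ih.1]
      refine ⟨?_, add_nonneg (le_max_right _ _) ih.2⟩
      rw [ENNReal.ofReal_add (le_max_right _ _) ih.2]
      congr 1
      rcases le_total (L e) 0 with h | h
      · simp [h]
      · simp [h]
  rw [key]
  rw [hs.1, ← ENNReal.ofReal_coe_nnreal, ENNReal.ofReal_le_ofReal_iff t.coe_nonneg] at h
  gcongr

/-- The discounted indicator that `x :: l` is a self-avoiding path. -/
noncomputable def pathWeight {V : Type*} (θ : ℝ) (G : SimpleGraph V) (L : Sym2 V → ℝ) (x : V)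
    (l : List V) : ℝ≥0∞ :=
  open Classical in
  if (x :: l).Nodup ∧ ∀ e ∈ chainEdges x l, e ∈ G.edgeSet then
    ((chainEdges x l).map fun e => discount θ (L e)).prod
  else 0

theorem exists_pathWeight_of_mem_ballL {V : Type*} {θ : ℝ} (hθ : 0 ≤ θ) {G : SimpleGraph V}
    {L : Sym2 V → ℝ} {x y : V} {t : ℝ≥0} (hy : y ∈ ballL G L x t) :
    ∃ l : List V, (x :: l).getLast (List.cons_ne_nil x l) = y ∧
      ENNReal.ofReal (Real.exp (-(θ * (t + 1)))) ≤ pathWeight θ G L x l := by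
  -- The infimum defining the distance need not be attained; the extra 1 leaves room for an actual
  -- path.
  have hlt : distL G L x y < ((t + 1 : ℝ≥0) : ℝ≥0∞) :=
    lt_of_le_of_lt hy (ENNReal.coe_lt_coe.2 (lt_add_one t))
  obtain ⟨p, hp⟩ := iInf_lt_iff.1 hlt
  obtain ⟨l, h1, h2, h3⟩ := exists_chain_of_walk (p : G.Walk x y)
  refine ⟨l, h3, ?_⟩
  have hn : (x :: l).Nodup := h1 ▸ p.2.support_nodup
  have he : ∀ e ∈ chainEdges x l, e ∈ G.edgeSet := fun e he =>
    SimpleGraph.Walk.edges_subset_edgeSet (p : G.Walk x y) (h2 ▸ he)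
  rw [pathWeight, if_pos ⟨hn, he⟩]
  have := prod_discount θ hθ L (chainEdges x l) (t + 1) (by
    rw [← h2]; exact hp.le)
  simpa using this

/-- An exponential Markov bound: paths to different end points are different lists, so each vertex
of the ball accounts for its own term of size at least exp(-θ(t + 1)). -/
theorem encard_ballL_le {V : Type*} {θ : ℝ} (hθ : 0 ≤ θ) (G : SimpleGraph V) (L : Sym2 V → ℝ)
    (x : V) (t : ℝ≥0) :
    ((ballL G L x t).encard : ℝ≥0∞) ≤
      (∑' l, pathWeight θ G L x l) * ENNReal.ofReal (Real.exp (θ * (t + 1))) := by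
  choose l hl hw using fun y : ballL G L x t => exists_pathWeight_of_mem_ballL hθ y.2
  have hinj : Function.Injective l := fun y z h => Subtype.ext (by
    rw [← hl y, ← hl z]; simp only [h])
  have h1 : ∑' _ : ballL G L x t, ENNReal.ofReal (Real.exp (-(θ * (t + 1)))) ≤
      ∑' l, pathWeight θ G L x l :=
    (ENNReal.tsum_le_tsum hw).trans (ENNReal.tsum_comp_le_tsum_of_injective hinj _)
  rw [ENNReal.tsum_const] at h1
  calc ((ballL G L x t).encard : ℝ≥0∞)
      = ((ballL G L x t).encard : ℝ≥0∞) * ENNReal.ofReal (Real.exp (-(θ * (t + 1)))) *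
          ENNReal.ofReal (Real.exp (θ * (t + 1))) := by
        rw [mul_assoc, ← ENNReal.ofReal_mul (Real.exp_pos _).le, ← Real.exp_add]
        simp
    _ ≤ _ := by gcongr; exact h1

theorem ballL_finite_of_tsum {V : Type*} {θ : ℝ} (hθ : 0 ≤ θ) {G : SimpleGraph V}
    {L : Sym2 V → ℝ} {x : V} (hZ : ∑' l, pathWeight θ G L x l ≠ ⊤) (t : ℝ≥0) :
    (ballL G L x t).Finite ∧ ((ballL G L x t).ncard : ℝ) ≤
      (∑' l, pathWeight θ G L x l).toReal * Real.exp (θ * (t + 1)) := by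
  have h := encard_ballL_le hθ G L x t
  have hfin : (ballL G L x t).Finite := by
    rw [← Set.encard_ne_top_iff]
    intro htop
    rw [htop] at h
    exact ENNReal.mul_ne_top hZ ENNReal.ofReal_ne_top (top_le_iff.1 (by simpa using h))
  refine ⟨hfin, ?_⟩
  rw [← hfin.cast_ncard_eq] at h
  have h2 := ENNReal.toReal_mono (ENNReal.mul_ne_top hZ ENNReal.ofReal_ne_top) h
  rw [ENNReal.toReal_mul, ENNReal.toReal_ofReal (Real.exp_pos _).le] at h2
  simpa using h2

theorem passTime_le_hitTime {V : Type*} (G : SimpleGraph V) (L : Sym2 V → ℝ) (x : V) (n : ℕ) :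
    passTime G L x n ≤ hitTime G L x n :=
  le_iInf₂ fun t ht => iInf₂_le t ht.ge

theorem exists_ncard_ballL_le_exp {V : Type*} {θ : ℝ} (hθ : 0 ≤ θ) {G : SimpleGraph V}
    {L : Sym2 V → ℝ} {x : V} (hZ : ∑' l, pathWeight θ G L x l ≠ ⊤) :
    ∃ t₀ : ℝ≥0, ∀ t : ℝ≥0, t₀ ≤ t → (ballL G L x t).Finite ∧
      ((ballL G L x t).ncard : ℝ) ≤ Real.exp ((θ + 1) * t) := by
  set z := (∑' l, pathWeight θ G L x l).toReal with hz
  have hz0 : 0 ≤ z := ENNReal.toReal_nonneg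
  -- Beyond this radius the extra unit of rate absorbs both the prefactor, through z ≤ exp z, and
  -- the factor exp θ.
  refine ⟨⟨z + θ, by positivity⟩, fun t ht => ?_⟩
  have ht' : z + θ ≤ t := ht
  obtain ⟨h1, h2⟩ := ballL_finite_of_tsum hθ hZ t
  refine ⟨h1, h2.trans ?_⟩
  calc z * Real.exp (θ * (t + 1)) ≤ Real.exp z * Real.exp (θ * (t + 1)) := by
        gcongr; linarith [Real.add_one_le_exp z]
    _ = Real.exp (z + θ * (t + 1)) := (Real.exp_add _ _).symm
    _ ≤ _ := by gcongr; linarith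

theorem eventually_log_le_passTime {V : Type*} {C : ℝ} (hC : 0 < C) {G : SimpleGraph V}
    {L : Sym2 V → ℝ} {x : V}
    (h : ∃ t₀ : ℝ≥0, ∀ t : ℝ≥0, t₀ ≤ t → (ballL G L x t).Finite ∧
      ((ballL G L x t).ncard : ℝ) ≤ Real.exp (C * t)) :
    ∃ n₀ : ℕ, ∀ n : ℕ, n₀ ≤ n → ENNReal.ofReal (C⁻¹ * Real.log n) ≤ passTime G L x n := by
  obtain ⟨t₀, h⟩ := h
  -- This choice rules out t < t₀: the ball of radius t₀ has fewer than n₀ points.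
  obtain ⟨n₀, hn₀⟩ := exists_nat_gt (Real.exp (C * t₀))
  refine ⟨n₀, fun n hn => le_iInf₂ fun t ht => ?_⟩
  have hpos : (0 : ℝ) < n := (Real.exp_pos _).trans (hn₀.trans_le (by exact_mod_cast hn))
  have key : ∀ s : ℝ≥0, t₀ ≤ s → t ≤ s → (n : ℝ) ≤ Real.exp (C * s) := by
    intro s hs hts
    obtain ⟨h1, h2⟩ := h s hs
    refine le_trans ?_ h2
    have hsub : ballL G L x t ⊆ ballL G L x s := fun y hy =>
      le_trans hy (ENNReal.coe_le_coe.2 hts)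
    have := ht.trans (Set.encard_le_encard hsub)
    rw [← h1.cast_ncard_eq] at this
    exact_mod_cast this
  have hts : t₀ ≤ t := by
    by_contra! hlt
    have := key t₀ le_rfl hlt.le
    have h3 : (n₀ : ℝ) ≤ n := by exact_mod_cast hn
    linarith
  have := (Real.log_le_iff_le_exp hpos).2 (key t hts le_rfl)
  rw [← ENNReal.ofReal_coe_nnreal]
  apply ENNReal.ofReal_le_ofReal
  rw [inv_mul_le_iff₀ hC]
  exact this

theorem tendsto_of_log_le {c : ℝ} (hc : 0 < c) {f : ℕ → ℝ≥0∞}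
    (h : ∃ n₀ : ℕ, ∀ n : ℕ, n₀ ≤ n → ENNReal.ofReal (c * Real.log n) ≤ f n) :
    Tendsto f atTop (𝓝 ⊤) := by
  have h1 : Tendsto (fun n : ℕ => ENNReal.ofReal (c * Real.log n)) atTop (𝓝 ⊤) :=
    ENNReal.tendsto_ofReal_atTop.comp
      ((Real.tendsto_log_atTop.comp tendsto_natCast_atTop_atTop).const_mul_atTop hc)
  obtain ⟨n₀, h⟩ := h
  exact tendsto_nhds_top_mono h1 ((eventually_ge_atTop n₀).mono h)

end SFP

/-! ### Moments, the Laplace transform at infinity, and lattice sums -/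

namespace SFP

/-- A dyadic tail bound gives a finite moment. -/
theorem lintegral_rpow_lt_top_of_dyadic {ν : Measure ℝ} [IsProbabilityMeasure ν]
    (hν : ν (Ici 1) = 1) {p q T : ℝ} (hp : 0 ≤ p) (hpq : p < q) (hT : 1 ≤ T)
    (h : ∀ k : ℕ, ν.real (Ioi (2 ^ k * T)) ≤ ((2 : ℝ) ^ (-q)) ^ k) :
    ∫⁻ w, ENNReal.ofReal (w ^ p) ∂ν < ⊤ := by
  have hae : ∀ᵐ w ∂ν, w ∈ Ici (1 : ℝ) := by
    rw [← prob_compl_eq_zero_iff measurableSet_Ici] at hν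
    exact hν
  -- On the shell (2^k T, 2^(k+1) T] the k-th term alone dominates w^p. Enlarging shells to
  -- half-lines lets the tail bound apply directly, and leaves a geometric series of ratio 2^(p-q).
  set g : ℝ → ℝ≥0∞ := fun w => ENNReal.ofReal (T ^ p) +
    ∑' k : ℕ, (Ioi ((2 : ℝ) ^ k * T)).indicator
      (fun _ => ENNReal.ofReal (((2 : ℝ) ^ (k + 1) * T) ^ p)) w with hg
  have hle : ∀ᵐ w ∂ν, ENNReal.ofReal (w ^ p) ≤ g w := by
    filter_upwards [hae] with w hw
    have hw : (1 : ℝ) ≤ w := hw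
    rcases le_or_gt w T with hwT | hwT
    · refine le_add_right (ENNReal.ofReal_le_ofReal ?_)
      exact Real.rpow_le_rpow (by linarith) hwT hp
    · have hex : ∃ k : ℕ, w ≤ 2 ^ (k + 1) * T := by
        obtain ⟨k, hk⟩ := pow_unbounded_of_one_lt w (one_lt_two)
        refine ⟨k, hk.le.trans ?_⟩
        have : (2 : ℝ) ^ k ≤ 2 ^ (k + 1) := pow_le_pow_right₀ one_le_two (Nat.le_succ k)
        nlinarith [pow_pos (two_pos : (0 : ℝ) < 2) (k + 1)]
      classical
      have hk := Nat.find_spec hex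
      have hk' : 2 ^ (Nat.find hex) * T < w := by
        rcases Nat.eq_zero_or_pos (Nat.find hex) with h0 | h0
        · rw [h0]; simpa using hwT
        · have := Nat.find_min hex (Nat.sub_lt h0 one_pos)
          rw [Nat.sub_add_cancel (Nat.one_le_iff_ne_zero.2 h0.ne')] at this
          exact not_le.1 this
      refine le_add_left (le_trans ?_ (ENNReal.le_tsum (Nat.find hex)))
      rw [indicator_of_mem (show w ∈ Ioi _ from hk')]
      exact ENNReal.ofReal_le_ofReal (Real.rpow_le_rpow (by linarith) hk hp)
  refine (lintegral_mono_ae hle).trans_lt ?_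
  have hmeas : ∀ k : ℕ, Measurable ((Ioi ((2 : ℝ) ^ k * T)).indicator
      (fun _ => ENNReal.ofReal (((2 : ℝ) ^ (k + 1) * T) ^ p))) :=
    fun k => measurable_const.indicator measurableSet_Ioi
  rw [hg, lintegral_add_left measurable_const, lintegral_tsum fun k => (hmeas k).aemeasurable]
  refine ENNReal.add_lt_top.2 ⟨by simp, ?_⟩
  have hr : (2 : ℝ) ^ (p - q) < 1 := Real.rpow_lt_one_of_one_lt_of_neg one_lt_two (by linarith)
  have hsum : Summable fun k : ℕ => (2 * T) ^ p * ((2 : ℝ) ^ (p - q)) ^ k :=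
    (summable_geometric_of_lt_one (by positivity) hr).mul_left _
  refine lt_of_le_of_lt (ENNReal.tsum_le_tsum fun k => ?_) hsum.tsum_ofReal_ne_top.lt_top
  rw [lintegral_indicator measurableSet_Ioi, lintegral_const, Measure.restrict_apply_univ,
    ← ofReal_measureReal, ← ENNReal.ofReal_mul (by positivity)]
  apply ENNReal.ofReal_le_ofReal
  calc ((2 : ℝ) ^ (k + 1) * T) ^ p * ν.real (Ioi (2 ^ k * T))
      ≤ ((2 : ℝ) ^ (k + 1) * T) ^ p * ((2 : ℝ) ^ (-q)) ^ k := by gcongr; exact h k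
    _ = (2 * T) ^ p * ((2 : ℝ) ^ (p - q)) ^ k := by
      rw [show (2 : ℝ) ^ (k + 1) * T = 2 ^ k * (2 * T) by ring,
        Real.mul_rpow (by positivity) (by positivity), sub_eq_add_neg,
        Real.rpow_add two_pos, mul_pow, ← Real.rpow_pow_comm two_pos.le p k]
      ring

theorem IsThinTailed.lintegral_rpow_lt_top {ν : Measure ℝ} [IsProbabilityMeasure ν]
    (hν : ν (Ici 1) = 1) (h : IsThinTailed ν) {p : ℝ} (hp : 0 ≤ p) :
    ∫⁻ w, ENNReal.ofReal (w ^ p) ∂ν < ⊤ := by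
  have h1 := (h (p + 1) (by linarith)).eventually (ge_mem_nhds one_pos)
  obtain ⟨T, hT⟩ := eventually_atTop.1 (h1.and (eventually_ge_atTop 1))
  refine lintegral_rpow_lt_top_of_dyadic hν (q := p + 1) (T := max T 1) hp (by linarith)
    (le_max_right _ _) fun k => ?_
  have h2 : (1 : ℝ) ≤ 2 ^ k := one_le_pow₀ one_le_two
  have h3 : (1 : ℝ) ≤ max T 1 := le_max_right _ _
  have h4 := (hT (2 ^ k * max T 1) (by nlinarith [le_max_left T 1])).1
  have h5 : ((2 : ℝ) ^ k) ^ (p + 1) * ν.real (Ioi (2 ^ k * max T 1)) ≤ 1 := by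
    refine le_trans ?_ h4
    gcongr
    nlinarith
  rw [Real.rpow_pow_comm two_pos.le, Real.rpow_neg (by positivity), ← one_div,
    le_div_iff₀ (by positivity), mul_comm]
  exact h5

/-- Slow variation is needed only for the factor 2: for q strictly between p and τ - 1, doubling a
large t shrinks the tail by at least 2^(-q), and iteration gives the dyadic bound. -/
theorem IsPowerLaw.lintegral_rpow_lt_top {ν : Measure ℝ} [IsProbabilityMeasure ν]
    (hν : ν (Ici 1) = 1) {τ : ℝ} (h : IsPowerLaw ν τ) {p : ℝ} (hp : 0 ≤ p) (hpτ : p < τ - 1) :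
    ∫⁻ w, ENNReal.ofReal (w ^ p) ∂ν < ⊤ := by
  obtain ⟨ℓ, hℓ, htail⟩ := h
  obtain ⟨q, hpq, hq⟩ := exists_between hpτ
  have hlt : (1 : ℝ) < 2 ^ (τ - 1 - q) := Real.one_lt_rpow one_lt_two (by linarith)
  have h1 := (hℓ 2 two_pos).eventually (gt_mem_nhds hlt)
  have h0 := (hℓ 2 two_pos).eventually (lt_mem_nhds one_pos)
  obtain ⟨T, hT⟩ := eventually_atTop.1 (h1.and h0)
  have hstep : ∀ t, max T 1 ≤ t → ν.real (Ioi (2 * t)) ≤ 2 ^ (-q) * ν.real (Ioi t) := by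
    intro t ht
    have ht1 : 1 ≤ t := (le_max_right _ _).trans ht
    obtain ⟨ha, hb⟩ := hT t ((le_max_left _ _).trans ht)
    have htp : 0 < t ^ (τ - 1) := Real.rpow_pos_of_pos (by linarith) _
    -- Division by zero being zero, a zero of ℓ would contradict the eventually positive ratio; the
    -- sign comes from the tail being nonnegative.
    have hℓ0 : 0 < ℓ t := by
      have hne : ℓ t ≠ 0 := fun h => by simp [h] at hb
      have : 0 ≤ ℓ t / t ^ (τ - 1) := by
        rw [← htail t (by linarith)]; exact measureReal_nonneg
      exact lt_of_le_of_ne (by simpa [div_nonneg_iff, htp.le, htp.not_ge] using this) hne.symm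
    rw [div_lt_iff₀ hℓ0] at ha
    rw [htail _ (by linarith), htail t (by linarith), Real.mul_rpow two_pos.le (by linarith)]
    have h2p : (0 : ℝ) < 2 ^ (τ - 1) := by positivity
    rw [div_le_iff₀ (by positivity)]
    have e : (2 : ℝ) ^ (τ - 1 - q) = 2 ^ (-q) * 2 ^ (τ - 1) := by
      rw [← Real.rpow_add two_pos]; ring_nf
    rw [e] at ha
    refine ha.le.trans (le_of_eq ?_)
    field_simp
  refine lintegral_rpow_lt_top_of_dyadic hν (q := q) (T := max T 1) hp hpq
    (le_max_right _ _) fun k => ?_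
  induction k with
  | zero => simp
  | succ k ih =>
    have h2 : (1 : ℝ) ≤ 2 ^ k := one_le_pow₀ one_le_two
    have := hstep (2 ^ k * max T 1) (by nlinarith [le_max_right T 1])
    rw [← mul_assoc, ← pow_succ'] at this
    rw [pow_succ' ((2 : ℝ) ^ (-q))]
    refine this.trans ?_
    gcongr

/-- Dominated convergence with majorant 1: the hypothesis makes r positive almost everywhere, so the
integrand tends to 0. -/
theorem tendsto_lintegral_discount {ν : Measure ℝ} [IsProbabilityMeasure ν] (h : cdf ν 0 = 0) :
    Tendsto (fun n : ℕ => ∫⁻ r, ENNReal.ofReal (Real.exp (-((n : ℝ) * max r 0))) ∂ν)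
      atTop (𝓝 0) := by
  have hpos : ∀ᵐ r ∂ν, 0 < r := by
    rw [cdf_eq_real, measureReal_eq_zero_iff] at h
    rw [ae_iff]
    simpa [Iic, not_lt] using h
  have := tendsto_lintegral_filter_of_dominated_convergence (μ := ν) (l := atTop)
    (F := fun (n : ℕ) r => ENNReal.ofReal (Real.exp (-((n : ℝ) * max r 0)))) (f := fun _ => 0)
    (fun _ => 1) (Eventually.of_forall fun n => by fun_prop)
    (Eventually.of_forall fun n => Eventually.of_forall fun r => by
      rw [← ENNReal.ofReal_one]
      apply ENNReal.ofReal_le_ofReal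
      rw [Real.exp_le_one_iff]
      have : 0 ≤ max r 0 := le_max_right _ _
      nlinarith [(n.cast_nonneg : (0 : ℝ) ≤ n), mul_nonneg (n.cast_nonneg : (0 : ℝ) ≤ n) this])
    (by simp) (by
      filter_upwards [hpos] with r hr
      rw [← ENNReal.ofReal_zero]
      refine ENNReal.tendsto_ofReal (Real.tendsto_exp_atBot.comp ?_)
      refine tendsto_neg_atTop_atBot.comp ?_
      refine tendsto_natCast_atTop_atTop.atTop_mul_const ?_
      exact lt_max_of_lt_left hr)
  simpa using this

theorem one_le_eucl {d : ℕ} {x y : Lattice d} (h : x ≠ y) : 1 ≤ eucl x y := by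
  obtain ⟨i, hi⟩ := Function.ne_iff.1 h
  rw [eucl, Real.one_le_sqrt]
  refine le_trans ?_ (Finset.single_le_sum (f := fun i => ((x i : ℝ) - (y i : ℝ)) ^ 2)
    (fun i _ => sq_nonneg _) (Finset.mem_univ i))
  rw [one_le_sq_iff_one_le_abs]
  have : (1 : ℤ) ≤ |x i - y i| := Int.one_le_abs (sub_ne_zero.2 hi)
  exact_mod_cast this

theorem norm_le_eucl {d : ℕ} (x y : Lattice d) :
    ‖(fun i => ((y i - x i : ℤ) : ℝ) : Fin d → ℝ)‖ ≤ eucl x y := by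
  refine (pi_norm_le_iff_of_nonneg (Real.sqrt_nonneg _)).2 fun i => ?_
  rw [Real.norm_eq_abs]
  apply Real.abs_le_sqrt
  refine le_trans (le_of_eq ?_) (Finset.single_le_sum (f := fun i => ((x i : ℝ) - (y i : ℝ)) ^ 2)
    (fun i _ => sq_nonneg _) (Finset.mem_univ i))
  push_cast; ring

/-- The inverse powers of the Euclidean distance have a finite, translation invariant sum. -/
theorem exists_tsum_eucl_rpow_le (d : ℕ) {p : ℝ} (hp : (d : ℝ) < p) :
    ∃ A : ℝ≥0∞, A ≠ ⊤ ∧ ∀ x : Lattice d, ∑' y, ENNReal.ofReal (eucl x y ^ (-p)) ≤ A := by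
  have hp0 : 0 < p := (Nat.cast_nonneg d).trans_lt hp
  set b := Pi.basisFun ℝ (Fin d)
  set Λ := Submodule.span ℤ (Set.range b)
  have hfr : Module.finrank ℤ Λ = d := by
    rw [ZLattice.rank ℝ Λ]; simp
  have hs := ZLattice.summable_norm_rpow Λ (-p) (by rw [hfr]; linarith)
  have hmem : ∀ z : Lattice d, (fun i => (z i : ℝ)) ∈ Λ := by
    intro z
    rw [Module.Basis.mem_span_iff_repr_mem]
    intro i
    exact ⟨z i, by simp [b]⟩
  let f : Lattice d → Λ := fun z => ⟨_, hmem z⟩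
  have hf : Function.Injective f := by
    intro z w h
    funext i
    have := congrFun (congrArg Subtype.val h) i
    exact Int.cast_injective this
  -- The lattice sum is taken in the sup norm, which is at most the Euclidean one; the exponent is
  -- negative.
  refine ⟨∑' z : Λ, ENNReal.ofReal (‖z‖ ^ (-p)), hs.tsum_ofReal_ne_top, fun x => ?_⟩
  have hinj : Function.Injective fun y : Lattice d => f (y - x) :=
    hf.comp sub_left_injective
  refine le_trans (ENNReal.tsum_le_tsum fun y => ?_)
    (ENNReal.tsum_comp_le_tsum_of_injective hinj fun z : Λ => ENNReal.ofReal (‖z‖ ^ (-p)))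
  apply ENNReal.ofReal_le_ofReal
  have hnorm : ‖f (y - x)‖ ≤ eucl x y := norm_le_eucl x y
  -- The diagonal term vanishes by the convention that 0 to a nonzero power is 0.
  by_cases hxy : x = y
  · subst hxy
    simp [eucl, Real.zero_rpow (neg_ne_zero.2 hp0.ne'), Real.rpow_nonneg]
  · refine Real.rpow_le_rpow_of_nonpos ?_ hnorm (by linarith)
    rw [norm_pos_iff]
    intro h0
    apply hxy
    have : f (y - x) = f 0 := by rw [h0]; ext i; simp [f]
    exact (sub_eq_zero.1 (hf this)).symm

end SFP

/-! ### Factorised bounds for edge probabilities and for chains -/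

namespace SFP

/-- The spatial factor of the bound for the edge probability. -/
noncomputable def edgeKernel {d : ℕ} (α lam s : ℝ) : Sym2 (Lattice d) → ℝ≥0∞ :=
  Sym2.lift ⟨fun x y => ENNReal.ofReal (max lam 1 ^ s * eucl x y ^ (-(α * s))), fun x y => by
    simp only [eucl_comm x y]⟩

/-- The vertex-weight factor of the bound for the edge probability. -/
noncomputable def edgeWeight {V : Type*} (s : ℝ) (w : V → ℝ) : Sym2 V → ℝ≥0∞ :=
  Sym2.lift ⟨fun x y => ENNReal.ofReal (w x ^ s) * ENNReal.ofReal (w y ^ s), fun _ _ =>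
    mul_comm _ _⟩

/-- The left side is at most min(z, 1). The free exponent s trades spatial decay against moments of
the vertex-weights. -/
theorem one_sub_exp_neg_le_rpow {z s : ℝ} (hz : 0 ≤ z) (hs0 : 0 ≤ s) (hs1 : s ≤ 1) :
    1 - Real.exp (-z) ≤ z ^ s := by
  rcases le_total z 1 with h | h
  · rcases hz.eq_or_lt with rfl | hz
    · simpa using Real.rpow_nonneg le_rfl s
    · calc 1 - Real.exp (-z) ≤ z := by linarith [Real.add_one_le_exp (-z)]
        _ = z ^ (1 : ℝ) := (Real.rpow_one z).symm
        _ ≤ z ^ s := Real.rpow_le_rpow_of_exponent_ge hz h hs1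
  · linarith [Real.one_le_rpow h hs0, Real.exp_pos (-z)]

theorem edgeKernel_mul_edgeWeight {d : ℕ} {α lam s : ℝ} {w : Lattice d → ℝ}
    (hw : ∀ x, 1 ≤ w x) (x y : Lattice d) :
    edgeKernel α lam s s(x, y) * edgeWeight s w s(x, y) =
      ENNReal.ofReal ((max lam 1 * (w x * w y)) ^ s * eucl x y ^ (-(α * s))) := by
  have hx := zero_le_one.trans (hw x)
  have hy := zero_le_one.trans (hw y)
  have hl : 0 ≤ max lam 1 := zero_le_one.trans (le_max_right _ _)
  have he : 0 ≤ eucl x y := Real.sqrt_nonneg _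
  simp only [edgeKernel, edgeWeight, Sym2.lift_mk]
  rw [← ENNReal.ofReal_mul (by positivity), ← ENNReal.ofReal_mul (by positivity),
    Real.mul_rpow hl (by positivity), Real.mul_rpow hx hy]
  congr 1
  ring

theorem ofReal_edgeProb_le {d : ℕ} {α lam s : ℝ} (hlam : 0 < lam) (hs0 : 0 ≤ s)
    (hs1 : s ≤ 1) {w : Lattice d → ℝ} (hw : ∀ x, 1 ≤ w x) (e : Sym2 (Lattice d)) :
    ENNReal.ofReal (edgeProb α lam w e) ≤ edgeKernel α lam s e * edgeWeight s w e := by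
  induction e with | _ x y
  have hx := zero_le_one.trans (hw x)
  have hy := zero_le_one.trans (hw y)
  have he : 0 ≤ eucl x y := Real.sqrt_nonneg _
  rw [edgeKernel_mul_edgeWeight hw]
  apply ENNReal.ofReal_le_ofReal
  simp only [edgeProb, Sym2.lift_mk]
  refine (one_sub_exp_neg_le_rpow (by positivity) hs0 hs1).trans ?_
  rw [Real.div_rpow (by positivity) (by positivity), ← Real.rpow_mul he, Real.rpow_neg he,
    div_eq_mul_inv]
  gcongr
  exact le_max_left _ _

/-- Nearest-neighbour pairs are always joined, so their bound must be at least 1. This is why the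
kernel carries `max lam 1` in place of `lam`. -/
theorem one_le_edgeKernel_mul_edgeWeight {d : ℕ} {α lam s : ℝ} (hs0 : 0 ≤ s)
    {w : Lattice d → ℝ} (hw : ∀ x, 1 ≤ w x) {e : Sym2 (Lattice d)} (hd : ¬ e.IsDiag)
    (hl : ¬ IsLong e) : 1 ≤ edgeKernel α lam s e * edgeWeight s w e := by
  induction e with | _ x y
  rw [Sym2.mk_isDiag_iff] at hd
  have h1 : eucl x y = 1 :=
    le_antisymm (not_lt.1 fun h => hl ⟨x, y, rfl, h⟩) (one_le_eucl hd)
  rw [edgeKernel_mul_edgeWeight hw, h1, Real.one_rpow, mul_one, ENNReal.one_le_ofReal]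
  refine Real.one_le_rpow ?_ hs0
  exact one_le_mul_of_one_le_of_one_le (le_max_right _ _)
    (one_le_mul_of_one_le_of_one_le (hw x) (hw y))

/-- An interior vertex lies on two consecutive edges and collects the power s twice. The last vertex
collects it once, and is raised to 2s because weights are at least 1. -/
theorem prod_edgeWeight_le {V : Type*} {s : ℝ} (hs0 : 0 ≤ s) {w : V → ℝ} (hw : ∀ x, 1 ≤ w x)
    (x : V) (l : List V) :
    ((chainEdges x l).map (edgeWeight s w)).prod ≤
      ENNReal.ofReal (w x ^ s) * (l.map fun v => ENNReal.ofReal (w v ^ (2 * s))).prod := by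
  induction l generalizing x with
  | nil => simpa [chainEdges] using Real.one_le_rpow (hw x) hs0
  | cons y l ih =>
    have hy := zero_lt_one.trans_le (hw y)
    simp only [chainEdges, List.map_cons, List.prod_cons]
    calc edgeWeight s w s(x, y) * ((chainEdges y l).map (edgeWeight s w)).prod
        ≤ (ENNReal.ofReal (w x ^ s) * ENNReal.ofReal (w y ^ s)) *
          (ENNReal.ofReal (w y ^ s) *
            (l.map fun v => ENNReal.ofReal (w v ^ (2 * s))).prod) := by
          gcongr
          · exact le_rfl
          · exact ih y
      _ = _ := by
          rw [two_mul, Real.rpow_add hy, ENNReal.ofReal_mul (by positivity)]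
          ring

theorem prod_edgeWeight_le_prod_cons {V : Type*} {s : ℝ} (hs0 : 0 ≤ s) {w : V → ℝ}
    (hw : ∀ x, 1 ≤ w x) (x : V) (l : List V) :
    ((chainEdges x l).map (edgeWeight s w)).prod ≤
      ((x :: l).map fun v => ENNReal.ofReal (w v ^ (2 * s))).prod := by
  refine (prod_edgeWeight_le hs0 hw x l).trans ?_
  rw [List.map_cons, List.prod_cons]
  gcongr
  · exact hw x
  · linarith

/-- Sums over vertex sequences of products of a kernel are bounded by a geometric series. -/
theorem tsum_prod_chainEdges_le {V : Type*} (k : Sym2 V → ℝ≥0∞) {A : ℝ≥0∞}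
    (hA : ∀ x, ∑' y, k s(x, y) ≤ A) (c : ℝ≥0∞) (x : V) :
    ∑' l : List V, ((chainEdges x l).map k).prod * c ^ l.length ≤ ∑' n : ℕ, (A * c) ^ n := by
  -- Splitting off the first step costs a factor A uniformly in the starting vertex, so the bound is
  -- proved for all x at once.
  have key : ∀ (n : ℕ) (x : V),
      ∑' v : Fin n → V, ((chainEdges x (List.ofFn v)).map k).prod ≤ A ^ n := by
    intro n
    induction n with
    | zero => intro x; simp [chainEdges]
    | succ n ih =>
      intro x
      rw [← (Fin.consEquiv fun _ : Fin (n + 1) => V).tsum_eq, ENNReal.tsum_prod']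
      calc _ = ∑' y, k s(x, y) * ∑' v : Fin n → V, ((chainEdges y (List.ofFn v)).map k).prod := by
            refine tsum_congr fun y => ?_
            rw [← ENNReal.tsum_mul_left]
            refine tsum_congr fun v => ?_
            simp [Fin.consEquiv, chainEdges]
        _ ≤ ∑' y, k s(x, y) * A ^ n := by gcongr with y; exact ih y
        _ ≤ A ^ (n + 1) := by
            rw [ENNReal.tsum_mul_right, pow_succ']
            gcongr
            exact hA x
  rw [← List.equivSigmaTuple.symm.tsum_eq, ENNReal.tsum_sigma']
  refine ENNReal.tsum_le_tsum fun n => ?_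
  simp only [List.equivSigmaTuple, Equiv.coe_fn_symm_mk, List.length_ofFn]
  rw [ENNReal.tsum_mul_right, mul_pow]
  gcongr
  exact key n x

theorem measurableSet_edges {Ω : Type u} {d : ℕ} (G : Ω → SimpleGraph (Lattice d)) (F : Finset (Sym2 (Lattice d))) :
    MeasurableSet[sigmaGraph G] {ω | ∀ e ∈ F, e ∈ (G ω).edgeSet} := by
  have : {ω | ∀ e ∈ F, e ∈ (G ω).edgeSet} = ⋂ e ∈ F, {ω | e ∈ (G ω).edgeSet} := by
    ext; simp
  rw [this]
  refine Finset.measurableSet_biInter F fun e _ => ?_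
  induction e with | _ x y
  exact MeasurableSpace.measurableSet_generateFrom ⟨x, y, rfl⟩

theorem measurable_prod_discount {Ω : Type u} {d : ℕ} (L : Sym2 (Lattice d) → Ω → ℝ) (θ : ℝ)
    (E : List (Sym2 (Lattice d))) :
    Measurable[sigmaLengths L] fun ω => (E.map fun e => discount θ (L e ω)).prod := by
  have hm : Measurable (discount θ) := by unfold discount; fun_prop
  induction E with
  | nil => simp
  | cons e E ih =>
    simp only [List.map_cons, List.prod_cons]
    refine Measurable.mul ?_ ih
    exact hm.comp ((comap_measurable (L e)).mono
      (le_iSup (fun e => MeasurableSpace.comap (L e) inferInstance) e) le_rfl)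

/-! ### Expected path weights in the percolation model -/

namespace IsScaleFreePercolation

variable {Ω : Type u} [MeasurableSpace Ω] {μ : Measure Ω} {d : ℕ}
  {α lam : ℝ} {νW νL : Measure ℝ} {W : Lattice d → Ω → ℝ} {G : Ω → SimpleGraph (Lattice d)}
  {L : Sym2 (Lattice d) → Ω → ℝ}

theorem sigmaWeights_le (h : IsScaleFreePercolation μ α lam νW νL W G L) :
    sigmaWeights W ≤ ‹MeasurableSpace Ω› :=
  iSup_le fun x => (h.measurable_weight x).comap_le

theorem sigmaLengths_le (h : IsScaleFreePercolation μ α lam νW νL W G L) :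
    sigmaLengths L ≤ ‹MeasurableSpace Ω› :=
  iSup_le fun e => (h.measurable_length e).comap_le

theorem sigmaGraph_le (h : IsScaleFreePercolation μ α lam νW νL W G L) :
    sigmaGraph G ≤ ‹MeasurableSpace Ω› := by
  refine MeasurableSpace.generateFrom_le ?_
  rintro _ ⟨x, y, rfl⟩
  exact h.measurable_adj x y

theorem one_le_weight (h : IsScaleFreePercolation μ α lam νW νL W G L)
    [IsProbabilityMeasure νW] (hW1 : νW (Ici 1) = 1) : ∀ᵐ ω ∂μ, ∀ x, 1 ≤ W x ω := by
  rw [ae_all_iff]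
  intro x
  have : ∀ᵐ w ∂(μ.map (W x)), w ∈ Ici (1 : ℝ) := by
    rw [h.law_weight x]
    rw [← prob_compl_eq_zero_iff measurableSet_Ici] at hW1
    exact hW1
  exact ae_of_ae_map (h.measurable_weight x).aemeasurable this

theorem measure_edges_eq [IsProbabilityMeasure μ]
    (h : IsScaleFreePercolation μ α lam νW νL W G L)
    {F : Finset (Sym2 (Lattice d))} (hF : ∀ e ∈ F, IsLong e) :
    μ {ω | ∀ e ∈ F, e ∈ (G ω).edgeSet} =
      ∫⁻ ω, ENNReal.ofReal (∏ e ∈ F, edgeProb α lam (fun x => W x ω) e) ∂μ := by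
  have hc := h.cond_edges F hF
  have hA : MeasurableSet {ω | ∀ e ∈ F, e ∈ (G ω).edgeSet} :=
    h.sigmaGraph_le _ (measurableSet_edges G F)
  -- Almost sure nonnegativity of the product is inherited from the conditional probability it
  -- equals.
  have hnn : 0 ≤ᵐ[μ] μ[Set.indicator {ω | ∀ e ∈ F, e ∈ (G ω).edgeSet} (fun _ => (1 : ℝ)) |
      sigmaWeights W] :=
    condExp_nonneg (Eventually.of_forall fun ω => indicator_nonneg (fun _ _ => zero_le_one) ω)
  rw [← ofReal_integral_eq_lintegral_ofReal (integrable_condExp.congr hc)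
    (hnn.trans hc.le), ← integral_congr_ae hc, integral_condExp h.sigmaWeights_le,
    integral_indicator_const _ hA, smul_eq_mul, mul_one, ofReal_measureReal]

/-- Self-avoidance enters here: a repeated vertex would produce a higher moment of W, possibly
infinite. -/
theorem lintegral_prod_weight (h : IsScaleFreePercolation μ α lam νW νL W G L) (p : ℝ)
    {l : List (Lattice d)} (hl : l.Nodup) :
    ∫⁻ ω, (l.map fun v => ENNReal.ofReal (W v ω ^ p)).prod ∂μ =
      (∫⁻ w, ENNReal.ofReal (w ^ p) ∂νW) ^ l.length := by
  have hm : Measurable fun w : ℝ => ENNReal.ofReal (w ^ p) := by fun_prop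
  have hi := lintegral_prod_eq_prod_lintegral_of_indepFun l.toFinset
    (fun v ω => ENNReal.ofReal (W v ω ^ p)) (h.indep_weight.comp (fun _ w => _) fun _ => hm)
    (fun v => hm.comp (h.measurable_weight v))
  simp only [List.prod_toFinset _ hl] at hi
  rw [hi]
  have : ∀ v, ∫⁻ ω, ENNReal.ofReal (W v ω ^ p) ∂μ = ∫⁻ w, ENNReal.ofReal (w ^ p) ∂νW := by
    intro v
    rw [← h.law_weight v, lintegral_map hm (h.measurable_weight v)]
  simp [this]

theorem lintegral_prod_discount (h : IsScaleFreePercolation μ α lam νW νL W G L) (θ : ℝ)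
    {E : List (Sym2 (Lattice d))} (hE : E.Nodup) :
    ∫⁻ ω, (E.map fun e => discount θ (L e ω)).prod ∂μ =
      (∫⁻ r, discount θ r ∂νL) ^ E.length := by
  have hm : Measurable (discount θ) := by unfold discount; fun_prop
  have hi := lintegral_prod_eq_prod_lintegral_of_indepFun E.toFinset
    (fun e ω => discount θ (L e ω)) (h.indep_length.comp (fun _ => discount θ) fun _ => hm)
    (fun e => hm.comp (h.measurable_length e))
  simp only [List.prod_toFinset _ hE] at hi
  rw [hi]
  have : ∀ e, ∫⁻ ω, discount θ (L e ω) ∂μ = ∫⁻ r, discount θ r ∂νL := by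
    intro e
    rw [← h.law_length e, lintegral_map hm (h.measurable_length e)]
  simp [this]

/-- The conditional law covers long pairs only. The other edges are dropped from the event and then
restored in the bound, where their factors are at least 1. -/
theorem measure_path_le [IsProbabilityMeasure μ]
    (h : IsScaleFreePercolation μ α lam νW νL W G L)
    [IsProbabilityMeasure νW] (hW1 : νW (Ici 1) = 1) (hlam : 0 < lam) {s : ℝ} (hs0 : 0 ≤ s)
    (hs1 : s ≤ 1) {x : Lattice d} {l : List (Lattice d)} (hl : (x :: l).Nodup) :
    μ {ω | ∀ e ∈ chainEdges x l, e ∈ (G ω).edgeSet} ≤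
      ((chainEdges x l).map (edgeKernel α lam s)).prod *
        (∫⁻ w, ENNReal.ofReal (w ^ (2 * s)) ∂νW) ^ (l.length + 1) := by
  classical
  set E := (chainEdges x l).toFinset with hE
  have hnd := nodup_chainEdges hl
  calc μ {ω | ∀ e ∈ chainEdges x l, e ∈ (G ω).edgeSet}
      ≤ μ {ω | ∀ e ∈ E.filter IsLong, e ∈ (G ω).edgeSet} :=
        measure_mono fun ω hω e he =>
          hω e (List.mem_toFinset.1 (Finset.mem_filter.1 he).1)
    _ = ∫⁻ ω, ENNReal.ofReal (∏ e ∈ E.filter IsLong, edgeProb α lam (fun x => W x ω) e) ∂μ :=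
        h.measure_edges_eq fun e he => (Finset.mem_filter.1 he).2
    _ ≤ ∫⁻ ω, ((chainEdges x l).map (edgeKernel α lam s)).prod *
          ((x :: l).map fun v => ENNReal.ofReal (W v ω ^ (2 * s))).prod ∂μ := by
        refine lintegral_mono_ae ?_
        filter_upwards [h.one_le_weight hW1] with ω hω
        have hnn : ∀ e, 0 ≤ edgeProb α lam (fun x => W x ω) e := by
          intro e
          induction e with | _ y z
          have hy := zero_le_one.trans (hω y)
          have hz := zero_le_one.trans (hω z)
          have he : 0 ≤ eucl y z := Real.sqrt_nonneg _
          simp only [edgeProb, Sym2.lift_mk, sub_nonneg, Real.exp_le_one_iff, neg_nonpos]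
          positivity
        rw [ENNReal.ofReal_prod_of_nonneg fun e _ => hnn e]
        calc ∏ e ∈ E.filter IsLong, ENNReal.ofReal (edgeProb α lam (fun x => W x ω) e)
            ≤ ∏ e ∈ E, edgeKernel α lam s e * edgeWeight s (fun x => W x ω) e := by
              rw [Finset.prod_filter]
              refine Finset.prod_le_prod' fun e he => ?_
              split_ifs with hlong
              · exact ofReal_edgeProb_le hlam hs0 hs1 hω e
              · exact one_le_edgeKernel_mul_edgeWeight hs0 hω
                  (not_isDiag_of_mem_chainEdges hl (List.mem_toFinset.1 he)) hlong
          _ = ((chainEdges x l).map (edgeKernel α lam s)).prod *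
              ((chainEdges x l).map (edgeWeight s fun x => W x ω)).prod := by
              rw [Finset.prod_mul_distrib, hE, List.prod_toFinset _ hnd,
                List.prod_toFinset _ hnd]
          _ ≤ _ := by gcongr; exact prod_edgeWeight_le_prod_cons hs0 hω x l
    _ = _ := by
        have hm : Measurable fun ω =>
            ((x :: l).map fun v => ENNReal.ofReal (W v ω ^ (2 * s))).prod := by
          simp only [← List.prod_toFinset _ hl]
          refine Finset.measurable_prod _ fun v _ => ?_
          have := h.measurable_weight v
          fun_prop
        rw [lintegral_const_mul _ hm, h.lintegral_prod_weight _ hl, List.length_cons]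

theorem lintegral_pathWeight_le [IsProbabilityMeasure μ]
    (h : IsScaleFreePercolation μ α lam νW νL W G L)
    [IsProbabilityMeasure νW] (hW1 : νW (Ici 1) = 1) (hlam : 0 < lam) {s : ℝ} (hs0 : 0 ≤ s)
    (hs1 : s ≤ 1) (θ : ℝ) (x : Lattice d) (l : List (Lattice d)) :
    AEMeasurable (fun ω => pathWeight θ (G ω) (fun e => L e ω) x l) μ ∧
    ∫⁻ ω, pathWeight θ (G ω) (fun e => L e ω) x l ∂μ ≤
      ((chainEdges x l).map (edgeKernel α lam s)).prod *
        ((∫⁻ w, ENNReal.ofReal (w ^ (2 * s)) ∂νW) * ∫⁻ r, discount θ r ∂νL) ^ l.length *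
        ∫⁻ w, ENNReal.ofReal (w ^ (2 * s)) ∂νW := by
  classical
  by_cases hl : (x :: l).Nodup
  swap
  · simp [pathWeight, hl]
  set A := {ω | ∀ e ∈ chainEdges x l, e ∈ (G ω).edgeSet} with hA
  have hAm : MeasurableSet[sigmaGraph G] A := by
    have := measurableSet_edges G (chainEdges x l).toFinset
    simp only [List.mem_toFinset] at this
    exact this
  -- The path weight is a graph event times a function of the edge-weights, and these are
  -- independent.
  have heq : (fun ω => pathWeight θ (G ω) (fun e => L e ω) x l) = fun ω =>
      A.indicator (fun _ => (1 : ℝ≥0∞)) ω *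
        ((chainEdges x l).map fun e => discount θ (L e ω)).prod := by
    funext ω
    by_cases hω : ω ∈ A
    · rw [pathWeight, if_pos ⟨hl, hω⟩, indicator_of_mem hω, one_mul]
    · rw [pathWeight, if_neg fun h => hω h.2, indicator_of_notMem hω, zero_mul]
  have hf : Measurable[sigmaWeights W ⊔ sigmaGraph G] (A.indicator (fun _ => (1 : ℝ≥0∞))) :=
    Measurable.indicator measurable_const (le_sup_right (a := sigmaWeights W) _ hAm)
  have hg := measurable_prod_discount L θ (chainEdges x l)
  have hle := sup_le h.sigmaWeights_le h.sigmaGraph_le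
  rw [heq]
  refine ⟨((hf.mono hle le_rfl).mul (hg.mono h.sigmaLengths_le le_rfl)).aemeasurable, ?_⟩
  rw [lintegral_mul_eq_lintegral_mul_lintegral_of_independent_measurableSpace hle
    h.sigmaLengths_le h.indep_graph_length hf hg, lintegral_indicator_const
    (h.sigmaGraph_le _ hAm), one_mul, h.lintegral_prod_discount θ (nodup_chainEdges hl),
    length_chainEdges]
  calc μ A * (∫⁻ r, discount θ r ∂νL) ^ l.length
      ≤ (((chainEdges x l).map (edgeKernel α lam s)).prod *
        (∫⁻ w, ENNReal.ofReal (w ^ (2 * s)) ∂νW) ^ (l.length + 1)) *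
        (∫⁻ r, discount θ r ∂νL) ^ l.length := by
        gcongr
        exact h.measure_path_le hW1 hlam hs0 hs1 hl
    _ = _ := by ring

/-- The expectation of the sum is at most a geometric series of ratio less than 1, times the finite
moment. -/
theorem tsum_pathWeight_ne_top [IsProbabilityMeasure μ]
    (h : IsScaleFreePercolation μ α lam νW νL W G L)
    [IsProbabilityMeasure νW] (hW1 : νW (Ici 1) = 1) (hlam : 0 < lam) {s : ℝ} (hs0 : 0 ≤ s)
    (hs1 : s ≤ 1) (hM : ∫⁻ w, ENNReal.ofReal (w ^ (2 * s)) ∂νW ≠ ⊤) {A : ℝ≥0∞}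
    (hA : ∀ x : Lattice d, ∑' y, edgeKernel α lam s s(x, y) ≤ A) {θ : ℝ}
    (hθ : A * ((∫⁻ w, ENNReal.ofReal (w ^ (2 * s)) ∂νW) * ∫⁻ r, discount θ r ∂νL) < 1)
    (x : Lattice d) :
    ∀ᵐ ω ∂μ, ∑' l, pathWeight θ (G ω) (fun e => L e ω) x l ≠ ⊤ := by
  have hl := h.lintegral_pathWeight_le hW1 hlam hs0 hs1 θ x
  have hlt : ∫⁻ ω, ∑' l, pathWeight θ (G ω) (fun e => L e ω) x l ∂μ ≠ ⊤ := by
    rw [lintegral_tsum fun l => (hl l).1]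
    refine ne_top_of_le_ne_top ?_ (ENNReal.tsum_le_tsum fun l => (hl l).2)
    rw [ENNReal.tsum_mul_right]
    refine ENNReal.mul_ne_top (ne_top_of_le_ne_top ?_ (tsum_prod_chainEdges_le _ hA _ x)) hM
    rw [ENNReal.tsum_geometric]
    exact ENNReal.inv_ne_top.2 (tsub_pos_of_lt hθ).ne'
  filter_upwards [ae_lt_top' (AEMeasurable.tsum fun l => (hl l).1) hlt] with ω hω
  exact hω.ne

end IsScaleFreePercolation

/-! ### Choice of the exponents and conclusion -/

theorem exists_tsum_edgeKernel_le {d : ℕ} {α lam s : ℝ} (h : (d : ℝ) < α * s) :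
    ∃ A : ℝ≥0∞, A ≠ ⊤ ∧ ∀ x : Lattice d, ∑' y, edgeKernel α lam s s(x, y) ≤ A := by
  obtain ⟨A, hA, hA'⟩ := exists_tsum_eucl_rpow_le d h
  refine ⟨ENNReal.ofReal (max lam 1 ^ s) * A, ENNReal.mul_ne_top ENNReal.ofReal_ne_top hA,
    fun x => ?_⟩
  have hl : 0 ≤ max lam 1 := zero_le_one.trans (le_max_right _ _)
  simp only [edgeKernel, Sym2.lift_mk, ENNReal.ofReal_mul (Real.rpow_nonneg hl s)]
  rw [ENNReal.tsum_mul_left]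
  gcongr
  exact hA' x

/-- A summable kernel needs s > d/α, while a finite moment is available for 2s < τ - 1; the two are
compatible exactly when γ > 2. For thin tails s = 1 works. -/
theorem exists_moment_exponent {d : ℕ} (hd : 1 ≤ d) {α : ℝ} (hα : (d : ℝ) < α) {νW : Measure ℝ}
    [IsProbabilityMeasure νW] (hW1 : νW (Ici 1) = 1)
    (hγ : (∃ τ : ℝ, 1 < τ ∧ IsPowerLaw νW τ ∧ 2 < α * (τ - 1) / d) ∨ IsThinTailed νW) :
    ∃ s : ℝ, 0 ≤ s ∧ s ≤ 1 ∧ (d : ℝ) < α * s ∧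
      ∫⁻ w, ENNReal.ofReal (w ^ (2 * s)) ∂νW ≠ ⊤ := by
  have hd0 : (0 : ℝ) < d := by exact_mod_cast hd
  have hα0 : 0 < α := hd0.trans hα
  have h1 : (d : ℝ) / α < 1 := (div_lt_one hα0).2 hα
  have h0 : 0 < (d : ℝ) / α := by positivity
  rcases hγ with ⟨τ, _, hp, hτ⟩ | ht
  · have h2 : (d : ℝ) / α < (τ - 1) / 2 := by
      rw [lt_div_iff₀ hd0] at hτ
      rw [div_lt_div_iff₀ hα0 two_pos]
      linarith
    obtain ⟨s, hs, hs'⟩ := exists_between (lt_min h1 h2)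
    rw [lt_min_iff] at hs'
    refine ⟨s, by linarith, hs'.1.le, by rwa [div_lt_iff₀' hα0] at hs, ?_⟩
    exact (hp.lintegral_rpow_lt_top hW1 (by linarith) (by linarith)).ne
  · refine ⟨1, zero_le_one, le_rfl, by linarith, ?_⟩
    exact (ht.lintegral_rpow_lt_top hW1 (by norm_num)).ne

end SFP

theorem mainTheorem6 (d : ℕ) (hd : 1 ≤ d) (α lam : ℝ) (hα : (d : ℝ) < α) (hlam : 0 < lam)
    (νW νL : Measure ℝ) [IsProbabilityMeasure νW] [IsProbabilityMeasure νL]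
    (hW1 : νW (Set.Ici 1) = 1)
    (hγ : (∃ τ : ℝ, 1 < τ ∧ SFP.IsPowerLaw νW τ ∧ 2 < α * (τ - 1) / d) ∨ SFP.IsThinTailed νW)
    (hL0 : cdf νL 0 = 0) :
    ∃ C : ℝ, 0 < C ∧ ∃ c : ℝ, 0 < c ∧
      ∀ (Ω : Type u) [MeasurableSpace Ω] (μ : Measure Ω) [IsProbabilityMeasure μ]
        (W : SFP.Lattice d → Ω → ℝ) (G : Ω → SimpleGraph (SFP.Lattice d))
        (L : Sym2 (SFP.Lattice d) → Ω → ℝ),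
        SFP.IsScaleFreePercolation μ α lam νW νL W G L →
        ∀ x : SFP.Lattice d, ∀ᵐ ω ∂μ,
          -- the ball grows at most exponentially
          (∃ t₀ : ℝ≥0, ∀ t : ℝ≥0, t₀ ≤ t →
            (SFP.ballL (G ω) (fun e => L e ω) x t).Finite ∧
            ((SFP.ballL (G ω) (fun e => L e ω) x t).ncard : ℝ) ≤ Real.exp (C * t)) ∧
          -- logarithmic lower bound
          (∃ n₀ : ℕ, ∀ n : ℕ, n₀ ≤ n →
            ENNReal.ofReal (c * Real.log n) ≤ SFP.hitTime (G ω) (fun e => L e ω) x n ∧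
            ENNReal.ofReal (c * Real.log n) ≤ SFP.passTime (G ω) (fun e => L e ω) x n) ∧
          -- the hitting times tend to infinity
          Tendsto (fun n : ℕ => SFP.hitTime (G ω) (fun e => L e ω) x n) atTop (𝓝 ⊤) ∧
          Tendsto (fun n : ℕ => SFP.passTime (G ω) (fun e => L e ω) x n) atTop (𝓝 ⊤) ∧
          -- no explosion
          (∀ t : ℝ≥0, (SFP.ballL (G ω) (fun e => L e ω) x t).Finite) := by
  obtain ⟨s, hs0, hs1, hds, hM⟩ := SFP.exists_moment_exponent hd hα hW1 hγ
  obtain ⟨A, hA, hA'⟩ := SFP.exists_tsum_edgeKernel_le (lam := lam) hds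
  set M := ∫⁻ w, ENNReal.ofReal (w ^ (2 * s)) ∂νW with hMdef
  -- As A and M are finite, the ratio tends to 0 with the Laplace transform. The resulting θ depends
  -- only on the parameters and the two laws.
  obtain ⟨θ, hθ⟩ : ∃ θ : ℕ, A * (M * ∫⁻ r, SFP.discount θ r ∂νL) < 1 := by
    have h1 := ENNReal.Tendsto.const_mul (SFP.tendsto_lintegral_discount hL0)
      (Or.inr (ENNReal.mul_ne_top hA hM))
    rw [mul_zero] at h1
    obtain ⟨θ, hθ⟩ := (h1.eventually (gt_mem_nhds one_pos)).exists
    exact ⟨θ, by rw [← mul_assoc]; exact hθ⟩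
  have hθ0 : (0 : ℝ) ≤ θ := Nat.cast_nonneg θ
  have hC : (0 : ℝ) < θ + 1 := by linarith
  -- The rate exceeds θ by 1 to absorb the random factor Z; inverting |B_t| ≤ exp(Ct) gives c = 1/C.
  refine ⟨θ + 1, hC, (θ + 1 : ℝ)⁻¹, inv_pos.2 hC, fun Ω _ μ _ W G L h x => ?_⟩
  filter_upwards [h.tsum_pathWeight_ne_top hW1 hlam hs0 hs1 hM hA' hθ x] with ω hZ
  have hgrow := SFP.exists_ncard_ballL_le_exp hθ0 hZ
  obtain ⟨n₀, hpass⟩ := SFP.eventually_log_le_passTime hC hgrow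
  have hhit : ∀ n : ℕ, n₀ ≤ n → ENNReal.ofReal ((θ + 1 : ℝ)⁻¹ * Real.log n) ≤
      SFP.hitTime (G ω) (fun e => L e ω) x n := fun n hn =>
    (hpass n hn).trans (SFP.passTime_le_hitTime _ _ x n)
  exact ⟨hgrow, ⟨n₀, fun n hn => ⟨hhit n hn, hpass n hn⟩⟩,
    SFP.tendsto_of_log_le (inv_pos.2 hC) ⟨n₀, hhit⟩,
    SFP.tendsto_of_log_le (inv_pos.2 hC) ⟨n₀, hpass⟩,
    fun t => (SFP.ballL_finite_of_tsum hθ0 hZ t).1⟩
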